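/- Let $(X,\mu)$ be a $\sigma$-finite measure space and let $(T_t)_{t>0}$ be a strongly continuous semigroup of symmetric contractions on $L^2(X,\mu)$ (real or complex valued functions) such that each $T_t$ maps $L^1(\mu)\cap L^2(\mu)$ into itself with $\|T_tf\|_1\le\|f\|_1$. Let $-A$ be its infinitesimal generator on $L^2(\mu)$: $\mathcal D(A)$ is the set of $f\in L^2(\mu)$ for which $\lim_{t\to0^+}\frac{T_tf-f}{t}$ exists in $L^2(\mu)$, and $-Af$ is this limit. Write $(\cdot,\cdot)$ for the inner product of $L^2(\mu)$. Let $\beta:(0,+\infty)\to(0,+\infty)$ be any function. Then the following three statements are equivalent. 1. (Super-Poincaré inequality for $A$ with rate function $\beta$.) For all $f\in\mathcal D(A)\cap L^1(\mu)$ and $r>0$, $$\|f\|_2^2\le r\,(Af,f)+\beta(r)\,\|f\|_1^2 .$$ 2. For all $f\in L^2(\mu)\cap L^1(\mu)$, $t>0$ and $r>0$, $$\|T_tf\|_2^2\le e^{-2t/r}\|f\|_2^2+(1-e^{-2t/r})\,\beta(r)\,\|f\|_1^2 .$$ 3. (A $(1,\infty)$-super-Poincaré inequality for $I-T_t$, for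 every $t>0$.) For all $f\in L^2(\mu)\cap L^1(\mu)$, $t>0$ and $r>1$, $$\|f\|_2^2\le r\,((I-T_t)f,f)+\beta\!\left(\frac{t}{\log\left(1+\frac1{r-1}\right)}\right)\|f\|_1^2 .$$ -/

import Mathlib

open MeasureTheory Filter Topology Set
open scoped ENNReal InnerProductSpace

noncomputable section

variable {X : Type*} [MeasurableSpace X] {μ : Measure X} {𝕜 : Type*} [RCLike 𝕜]

/-- A strongly continuous semigroup `(T_t)_{t > 0}` of symmetric contractions of `L²(X, μ)`, each of
which also maps `L¹ ∩ L²` into itself and contracts the `L¹` norm there.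
The values `T t` at times `t ≤ 0` play no role. -/
structure IsSymmetricContractionSemigroup (T : ℝ → Lp 𝕜 2 μ →L[𝕜] Lp 𝕜 2 μ) : Prop where
  map_add : ∀ s t : ℝ, 0 < s → 0 < t → T (s + t) = (T s).comp (T t)
  tendsto_zero : ∀ f : Lp 𝕜 2 μ, Tendsto (fun t : ℝ => T t f) (𝓝[>] 0) (𝓝 f)
  symmetric : ∀ t : ℝ, 0 < t → ∀ f g : Lp 𝕜 2 μ, ⟪T t f, g⟫_𝕜 = ⟪f, T t g⟫_𝕜
  contraction : ∀ t : ℝ, 0 < t → ∀ f : Lp 𝕜 2 μ, ‖T t f‖ ≤ ‖f‖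
  contraction_one : ∀ t : ℝ, 0 < t → ∀ f : Lp 𝕜 2 μ, MemLp f 1 μ →
    MemLp (T t f) 1 μ ∧ eLpNorm (T t f) 1 μ ≤ eLpNorm f 1 μ

/-- `h = lim_{t → 0⁺} (f - T_t f) / t` in `L²`, that is, `h = A f` where `-A` is the infinitesimal
generator of the semigroup. -/
def HasNegGenerator (T : ℝ → Lp 𝕜 2 μ →L[𝕜] Lp 𝕜 2 μ) (f h : Lp 𝕜 2 μ) : Prop :=
  Tendsto (fun t : ℝ => ((t : 𝕜)⁻¹) • (f - T t f)) (𝓝[>] 0) (𝓝 h)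

theorem HasNegGenerator.unique {T : ℝ → Lp 𝕜 2 μ →L[𝕜] Lp 𝕜 2 μ} {f h k : Lp 𝕜 2 μ}
    (h₁ : HasNegGenerator T f h) (h₂ : HasNegGenerator T f k) : h = k :=
  tendsto_nhds_unique h₁ h₂

theorem HasNegGenerator.add {T : ℝ → Lp 𝕜 2 μ →L[𝕜] Lp 𝕜 2 μ} {f g h k : Lp 𝕜 2 μ}
    (h₁ : HasNegGenerator T f h) (h₂ : HasNegGenerator T g k) :
    HasNegGenerator T (f + g) (h + k) := by
  refine (Tendsto.add h₁ h₂).congr fun t => ?_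
  rw [← smul_add, map_add]
  congr 1
  abel

theorem HasNegGenerator.smul {T : ℝ → Lp 𝕜 2 μ →L[𝕜] Lp 𝕜 2 μ} {f h : Lp 𝕜 2 μ}
    (c : 𝕜) (h₁ : HasNegGenerator T f h) : HasNegGenerator T (c • f) (c • h) := by
  refine (Tendsto.const_smul h₁ c).congr fun t => ?_
  rw [map_smul, ← smul_sub, smul_comm]

theorem HasNegGenerator.zero (T : ℝ → Lp 𝕜 2 μ →L[𝕜] Lp 𝕜 2 μ) :
    HasNegGenerator T (0 : Lp 𝕜 2 μ) 0 := by
  simp [HasNegGenerator]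

/-- The operator `A`, where `-A` is the infinitesimal generator of `T` in `L²`: its domain is the
set of all `f` for which `lim_{t → 0⁺} (f - T_t f) / t` exists in `L²`, and `A f` is that limit. -/
def negGenerator (T : ℝ → Lp 𝕜 2 μ →L[𝕜] Lp 𝕜 2 μ) : Lp 𝕜 2 μ →ₗ.[𝕜] Lp 𝕜 2 μ where
  domain :=
    { carrier := {f | ∃ h, HasNegGenerator T f h}
      add_mem' := fun ⟨_, ha⟩ ⟨_, hb⟩ => ⟨_, ha.add hb⟩
      zero_mem' := ⟨0, HasNegGenerator.zero T⟩
      smul_mem' := fun c _ ⟨_, ha⟩ => ⟨_, ha.smul c⟩ }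
  toFun :=
    { toFun := fun f => f.2.choose
      map_add' := fun f g =>
        (f + g).2.choose_spec.unique (f.2.choose_spec.add g.2.choose_spec)
      map_smul' := fun c f => (c • f).2.choose_spec.unique (f.2.choose_spec.smul c) }

theorem negGenerator_spec (T : ℝ → Lp 𝕜 2 μ →L[𝕜] Lp 𝕜 2 μ) (f : (negGenerator T).domain) :
    HasNegGenerator T f (negGenerator T f) :=
  f.2.choose_spec

/-- The `L¹(μ)` norm of (the class of) `f`, used for `f ∈ L¹ ∩ L²`. -/
def normOne (f : Lp 𝕜 2 μ) : ℝ := (eLpNorm f 1 μ).toReal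

/-- The operator `B` satisfies a super-Poincaré inequality with rate function `β` for all `r ∈ I`:
`‖f‖₂² ≤ r (B f, f) + β(r) ‖f‖₁²` for all `f ∈ D(B) ∩ L¹`. For a symmetric `B` the number
`(B f, f)` is real, so it agrees with its real part. -/
def SuperPoincareOn (B : Lp 𝕜 2 μ →ₗ.[𝕜] Lp 𝕜 2 μ) (β : ℝ → ℝ) (I : Set ℝ) : Prop :=
  ∀ f : B.domain, MemLp (f : Lp 𝕜 2 μ) 1 μ → ∀ r ∈ I,
    ‖(f : Lp 𝕜 2 μ)‖ ^ 2 ≤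
      r * RCLike.re ⟪B f, (f : Lp 𝕜 2 μ)⟫_𝕜 + β r * normOne (f : Lp 𝕜 2 μ) ^ 2

/-- The everywhere defined operator `I - S`. -/
def idSub (S : Lp 𝕜 2 μ →L[𝕜] Lp 𝕜 2 μ) : Lp 𝕜 2 μ →ₗ.[𝕜] Lp 𝕜 2 μ :=
  (LinearMap.id - (S : Lp 𝕜 2 μ →ₗ[𝕜] Lp 𝕜 2 μ)).toPMap ⊤

end

/-! From 1 to 2: for `f` in the domain of `A`, let `u(x) = ‖T_x f‖²` and `c = β(r) ‖f‖₁²`.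
Inequality 1 at `T_x f`, whose `L¹` norm is at most that of `f`, gives `u' = -2 (A T_x f, T_x f) ≤
-(2/r) (u - c)`, and Gronwall's argument yields 2. For general `f` in `L¹ ∩ L²`, apply this to the
averages `ε⁻¹ ∫₀^ε T_s f`: they lie in the domain, tend to `f` in `L²`, and do not increase the `L¹`
norm because `L¹` balls are closed and convex in `L²`. From 2 to 3: symmetry gives `‖T_{t/2} f‖² =
(T_t f, f)`, so 2 at time `t/2` rearranges to 3. From 3 to 1: fix `r` and take the parameter `(1 -
e^{-t/r})⁻¹` in 3. The argument of `β` is then exactly `r` for every `t`, and `t → 0⁺` turns the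
quadratic form of `I - T_t` into that of `A`. -/

open RCLike

section Semigroup

variable {X : Type*} [MeasurableSpace X] {μ : Measure X} {𝕜 : Type*} [RCLike 𝕜]
  {T : ℝ → Lp 𝕜 2 μ →L[𝕜] Lp 𝕜 2 μ}

/-! ### `L¹` balls inside `L²` -/

/-- The elements of `L²` whose `L¹` norm is at most `C` form a convex set. -/
theorem convex_setOf_eLpNorm_one_le (C : ℝ≥0∞) :
    Convex ℝ {f : Lp 𝕜 2 μ | eLpNorm f 1 μ ≤ C} := by
  intro f hf g hg a b ha hb hab
  simp only [mem_ofPred_eq] at hf hg ⊢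
  calc eLpNorm (a • f + b • g : Lp 𝕜 2 μ) 1 μ
      = eLpNorm (a • (f : X → 𝕜) + b • (g : X → 𝕜)) 1 μ := by
        refine eLpNorm_congr_ae ((Lp.coeFn_add _ _).trans ?_)
        exact (Lp.coeFn_smul a f).add (Lp.coeFn_smul b g)
    _ ≤ eLpNorm (a • (f : X → 𝕜)) 1 μ + eLpNorm (b • (g : X → 𝕜)) 1 μ :=
        eLpNorm_add_le ((Lp.aestronglyMeasurable f).const_smul a)
          ((Lp.aestronglyMeasurable g).const_smul b) le_rfl
    _ ≤ ENNReal.ofReal a * C + ENNReal.ofReal b * C := by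
        rw [eLpNorm_const_smul, eLpNorm_const_smul, Real.enorm_of_nonneg ha,
          Real.enorm_of_nonneg hb]
        gcongr
    _ = C := by rw [← add_mul, ← ENNReal.ofReal_add ha hb, hab, ENNReal.ofReal_one, one_mul]

/-- The elements of `L²` whose `L¹` norm is at most `C` form a closed set. -/
theorem isClosed_setOf_eLpNorm_one_le (C : ℝ≥0∞) :
    IsClosed {f : Lp 𝕜 2 μ | eLpNorm f 1 μ ≤ C} := by
  refine IsSeqClosed.isClosed fun u f hu hf => ?_
  -- Along an a.e. convergent subsequence, Fatou's lemma makes the `L¹` norm lower semicontinuous.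
  obtain ⟨ns, -, hns⟩ := (tendstoInMeasure_of_tendsto_Lp hf).exists_seq_tendsto_ae
  exact Lp.eLpNorm_le_of_ae_tendsto (.of_forall fun n => hu (ns n))
    (fun n => Lp.aestronglyMeasurable (u (ns n))) hns

theorem normOne_le_normOne {f g : Lp 𝕜 2 μ} (hg : MemLp g 1 μ)
    (h : eLpNorm f 1 μ ≤ eLpNorm g 1 μ) : normOne f ≤ normOne g :=
  ENNReal.toReal_mono hg.eLpNorm_ne_top h

theorem normOne_nonneg (f : Lp 𝕜 2 μ) : 0 ≤ normOne f := ENNReal.toReal_nonneg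

/-! ### Strong continuity of orbits -/

/-- The semigroup `T`, extended by the identity to times `t ≤ 0`. -/
noncomputable def extendedSemigroup (T : ℝ → Lp 𝕜 2 μ →L[𝕜] Lp 𝕜 2 μ) (t : ℝ) : Lp 𝕜 2 μ →L[𝕜] Lp 𝕜 2 μ :=
  if 0 < t then T t else ContinuousLinearMap.id 𝕜 _

theorem extendedSemigroup_of_pos {t : ℝ} (ht : 0 < t) : extendedSemigroup T t = T t :=
  if_pos ht

theorem extendedSemigroup_of_nonpos {t : ℝ} (ht : t ≤ 0) (f : Lp 𝕜 2 μ) :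
    extendedSemigroup T t f = f := by
  simp [extendedSemigroup, ht.not_gt]

namespace IsSymmetricContractionSemigroup

theorem extendedSemigroup_add (hT : IsSymmetricContractionSemigroup T) {s t : ℝ} (hs : 0 ≤ s)
    (ht : 0 ≤ t) (f : Lp 𝕜 2 μ) :
    extendedSemigroup T (s + t) f = extendedSemigroup T s (extendedSemigroup T t f) := by
  rcases hs.eq_or_lt with rfl | hs
  · simp [extendedSemigroup_of_nonpos le_rfl]
  rcases ht.eq_or_lt with rfl | ht
  · simp [extendedSemigroup_of_nonpos le_rfl]
  rw [extendedSemigroup_of_pos hs, extendedSemigroup_of_pos ht,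
    extendedSemigroup_of_pos (add_pos hs ht), hT.map_add s t hs ht]
  rfl

theorem norm_extendedSemigroup_le (hT : IsSymmetricContractionSemigroup T) (t : ℝ)
    (f : Lp 𝕜 2 μ) : ‖extendedSemigroup T t f‖ ≤ ‖f‖ := by
  rcases le_or_gt t 0 with ht | ht
  · rw [extendedSemigroup_of_nonpos ht]
  · rw [extendedSemigroup_of_pos ht]
    exact hT.contraction t ht f

theorem eLpNorm_one_extendedSemigroup_le (hT : IsSymmetricContractionSemigroup T) (t : ℝ)
    {f : Lp 𝕜 2 μ} (hf : MemLp f 1 μ) :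
    eLpNorm (extendedSemigroup T t f) 1 μ ≤ eLpNorm f 1 μ := by
  rcases le_or_gt t 0 with ht | ht
  · rw [extendedSemigroup_of_nonpos ht]
  · rw [extendedSemigroup_of_pos ht]
    exact (hT.contraction_one t ht f hf).2

theorem tendsto_extendedSemigroup_zero (hT : IsSymmetricContractionSemigroup T)
    (f : Lp 𝕜 2 μ) : Tendsto (fun t => extendedSemigroup T t f) (𝓝 0) (𝓝 f) := by
  rw [← nhdsLE_sup_nhdsGT (0 : ℝ)]
  refine Tendsto.sup ?_ ?_
  · refine tendsto_const_nhds.congr' ?_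
    filter_upwards [self_mem_nhdsWithin] with t ht
    exact (extendedSemigroup_of_nonpos ht f).symm
  · refine (hT.tendsto_zero f).congr' ?_
    filter_upwards [self_mem_nhdsWithin] with t ht
    rw [extendedSemigroup_of_pos ht]

theorem norm_extendedSemigroup_sub_le (hT : IsSymmetricContractionSemigroup T) {s t : ℝ}
    (hs : 0 ≤ s) (ht : 0 ≤ t) (f : Lp 𝕜 2 μ) :
    ‖extendedSemigroup T t f - extendedSemigroup T s f‖ ≤ ‖extendedSemigroup T |t - s| f - f‖ := by
  wlog hst : s ≤ t generalizing s t
  · rw [norm_sub_rev, abs_sub_comm]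
    exact this ht hs (le_of_not_ge hst)
  rw [abs_of_nonneg (sub_nonneg.2 hst)]
  have h := hT.extendedSemigroup_add hs (sub_nonneg.2 hst) f
  rw [add_sub_cancel] at h
  rw [h, ← map_sub]
  exact hT.norm_extendedSemigroup_le _ _

theorem continuous_extendedSemigroup (hT : IsSymmetricContractionSemigroup T) (f : Lp 𝕜 2 μ) :
    Continuous fun t => extendedSemigroup T t f := by
  -- The increment bound needs nonnegative times, so negative ones are clamped to `0`.
  have hmax : ∀ t, extendedSemigroup T t f = extendedSemigroup T (max t 0) f := fun t => by
    rcases le_total t 0 with ht | ht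
    · rw [max_eq_right ht, extendedSemigroup_of_nonpos ht, extendedSemigroup_of_nonpos le_rfl]
    · rw [max_eq_left ht]
  refine continuous_iff_continuousAt.2 fun s => tendsto_iff_norm_sub_tendsto_zero.2 ?_
  have hlim : Tendsto (fun t : ℝ => |max t 0 - max s 0|) (𝓝 s) (𝓝 0) :=
    (by fun_prop : Continuous fun t : ℝ => |max t 0 - max s 0|).tendsto' _ _ (by simp)
  refine squeeze_zero (fun _ => norm_nonneg _) (fun t => ?_)
    (tendsto_iff_norm_sub_tendsto_zero.1 ((hT.tendsto_extendedSemigroup_zero f).comp hlim))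
  simp only [Function.comp_apply]
  rw [hmax t, hmax s]
  exact hT.norm_extendedSemigroup_sub_le (le_max_right _ _) (le_max_right _ _) f

/-! ### The generator as a right derivative -/

theorem hasNegGenerator_iff {f h : Lp 𝕜 2 μ} :
    HasNegGenerator T f h ↔
      HasDerivWithinAt (fun t => extendedSemigroup T t f) (-h) (Ici 0) 0 := by
  rw [← hasDerivWithinAt_Ioi_iff_Ici, hasDerivWithinAt_iff_tendsto_slope' (by simp)]
  have hslope : slope (fun t => extendedSemigroup T t f) 0 =ᶠ[𝓝[>] 0]
      fun t : ℝ => -((t : 𝕜)⁻¹ • (f - T t f)) := by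
    filter_upwards [self_mem_nhdsWithin] with t ht
    rw [slope_def_module, extendedSemigroup_of_pos ht, extendedSemigroup_of_nonpos le_rfl,
      sub_zero, RCLike.real_smul_eq_coe_smul (K := 𝕜), ← smul_neg, neg_sub, RCLike.ofReal_inv]
  rw [tendsto_congr' hslope]
  exact ⟨fun H => H.neg, fun H => by simpa [HasNegGenerator] using H.neg⟩

theorem extendedSemigroup_comm (hT : IsSymmetricContractionSemigroup T) {s t : ℝ}
    (hs : 0 ≤ s) (ht : 0 ≤ t) (f : Lp 𝕜 2 μ) :
    extendedSemigroup T s (extendedSemigroup T t f) =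
      extendedSemigroup T t (extendedSemigroup T s f) := by
  rw [← hT.extendedSemigroup_add hs ht, add_comm, hT.extendedSemigroup_add ht hs]

theorem hasNegGenerator_extendedSemigroup (hT : IsSymmetricContractionSemigroup T)
    {f h : Lp 𝕜 2 μ} (hf : HasNegGenerator T f h) {s : ℝ} (hs : 0 ≤ s) :
    HasNegGenerator T (extendedSemigroup T s f) (extendedSemigroup T s h) := by
  refine (((extendedSemigroup T s).continuous.tendsto h).comp hf).congr' ?_
  filter_upwards [self_mem_nhdsWithin] with t (ht : 0 < t)
  rw [Function.comp_apply, map_smul, map_sub, ← extendedSemigroup_of_pos (T := T) ht,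
    hT.extendedSemigroup_comm hs ht.le]

/-- The orbit of `f` after time `s` is the orbit of `T_s f` from time `0`, and `T_s` commutes with
the generator. A right derivative is all that the later comparison argument requires. -/
theorem hasDerivWithinAt_extendedSemigroup (hT : IsSymmetricContractionSemigroup T)
    {f h : Lp 𝕜 2 μ} (hf : HasNegGenerator T f h) {s : ℝ} (hs : 0 ≤ s) :
    HasDerivWithinAt (fun t => extendedSemigroup T t f) (-extendedSemigroup T s h) (Ici s) s := by
  have h₀ := hasNegGenerator_iff.1 (hT.hasNegGenerator_extendedSemigroup hf hs)
  have h₁ : HasDerivWithinAt (fun t : ℝ => t - s) 1 (Ici s) s :=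
    ((hasDerivAt_id s).sub_const s).hasDerivWithinAt
  have h₂ := HasDerivWithinAt.scomp_of_eq s h₀ h₁
    (fun t ht => sub_nonneg.2 (show s ≤ t from ht)) (sub_self s).symm
  rw [one_smul] at h₂
  refine h₂.congr (fun t ht => ?_) ?_
  · rw [Function.comp_apply, ← hT.extendedSemigroup_add (sub_nonneg.2 ht) hs, sub_add_cancel]
  · rw [Function.comp_apply, sub_self, extendedSemigroup_of_nonpos le_rfl]

/-! ### Time averages of orbits -/

theorem extendedSemigroup_integral (hT : IsSymmetricContractionSemigroup T) (f : Lp 𝕜 2 μ)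
    {t ε : ℝ} (ht : 0 ≤ t) (hε : 0 ≤ ε) :
    extendedSemigroup T t (∫ s in 0..ε, extendedSemigroup T s f) =
      (∫ s in 0..t + ε, extendedSemigroup T s f) - ∫ s in 0..t, extendedSemigroup T s f := by
  have hint : ∀ a b, IntervalIntegrable (fun s => extendedSemigroup T s f) volume a b :=
    (hT.continuous_extendedSemigroup f).intervalIntegrable
  rw [← ContinuousLinearMap.intervalIntegral_comp_comm _ (hint 0 ε),
    intervalIntegral.integral_interval_sub_left (hint _ _) (hint _ _)]
  calc ∫ s in 0..ε, extendedSemigroup T t (extendedSemigroup T s f)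
      = ∫ s in 0..ε, extendedSemigroup T (t + s) f := by
        refine intervalIntegral.integral_congr fun s hs => ?_
        rw [uIcc_of_le hε] at hs
        exact (hT.extendedSemigroup_add ht hs.1 f).symm
    _ = ∫ s in t..t + ε, extendedSemigroup T s f := by
        rw [intervalIntegral.integral_comp_add_left (fun s => extendedSemigroup T s f), add_zero]

/-- The time averages of an orbit lie in the domain of the generator. -/
theorem hasNegGenerator_average (hT : IsSymmetricContractionSemigroup T) (f : Lp 𝕜 2 μ)
    {ε : ℝ} (hε : 0 ≤ ε) :
    HasNegGenerator T (ε⁻¹ • ∫ s in 0..ε, extendedSemigroup T s f)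
      (ε⁻¹ • (f - extendedSemigroup T ε f)) := by
  have hderiv : ∀ a, HasDerivAt (fun t => ∫ s in 0..t, extendedSemigroup T s f)
      (extendedSemigroup T a f) a := fun a =>
    intervalIntegral.integral_hasDerivAt_right
      ((hT.continuous_extendedSemigroup f).intervalIntegrable _ _)
      (hT.continuous_extendedSemigroup f).stronglyMeasurable.stronglyMeasurableAtFilter
      (hT.continuous_extendedSemigroup f).continuousAt
  have h₁ := (((hderiv (0 + ε)).comp_add_const 0 ε).sub (hderiv 0)).const_smul ε⁻¹
  rw [zero_add, extendedSemigroup_of_nonpos le_rfl] at h₁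
  rw [hasNegGenerator_iff, ← smul_neg, neg_sub]
  have hlin : ∀ t, 0 ≤ t →
      extendedSemigroup T t (ε⁻¹ • ∫ s in 0..ε, extendedSemigroup T s f) =
      ε⁻¹ • ((∫ s in 0..t + ε, extendedSemigroup T s f) -
        ∫ s in 0..t, extendedSemigroup T s f) := fun t ht => by
    rw [← hT.extendedSemigroup_integral f ht hε, map_real_smul _
      (extendedSemigroup T t).continuous]
  exact h₁.hasDerivWithinAt.congr (fun t ht => hlin t ht) (hlin 0 le_rfl)

theorem tendsto_average (hT : IsSymmetricContractionSemigroup T) (f : Lp 𝕜 2 μ) :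
    Tendsto (fun ε : ℝ => ε⁻¹ • ∫ s in 0..ε, extendedSemigroup T s f) (𝓝[>] 0) (𝓝 f) := by
  have hderiv : HasDerivAt (fun t => ∫ s in 0..t, extendedSemigroup T s f)
      (extendedSemigroup T 0 f) 0 :=
    intervalIntegral.integral_hasDerivAt_right
      ((hT.continuous_extendedSemigroup f).intervalIntegrable _ _)
      (hT.continuous_extendedSemigroup f).stronglyMeasurable.stronglyMeasurableAtFilter
      (hT.continuous_extendedSemigroup f).continuousAt
  rw [extendedSemigroup_of_nonpos le_rfl] at hderiv
  have h := (hasDerivWithinAt_iff_tendsto_slope' (by simp)).1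
    (hderiv.hasDerivWithinAt (s := Ioi 0))
  refine h.congr fun ε => ?_
  rw [slope_def_module, intervalIntegral.integral_same, sub_zero, sub_zero]

theorem eLpNorm_one_average_le (hT : IsSymmetricContractionSemigroup T) {f : Lp 𝕜 2 μ}
    (hf : MemLp f 1 μ) {ε : ℝ} (hε : 0 < ε) :
    eLpNorm (ε⁻¹ • ∫ s in 0..ε, extendedSemigroup T s f : Lp 𝕜 2 μ) 1 μ ≤ eLpNorm f 1 μ := by
  -- The orbit stays in a closed convex set, hence so does its average.
  have h := (convex_setOf_eLpNorm_one_le (𝕜 := 𝕜) (μ := μ) (eLpNorm f 1 μ)).set_average_mem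
    (isClosed_setOf_eLpNorm_one_le _) (μ := volume) (t := Ioc 0 ε)
    (f := fun s => extendedSemigroup T s f) (by simp [hε]) (by simp)
    (.of_forall fun s => hT.eLpNorm_one_extendedSemigroup_le s hf)
    ((hT.continuous_extendedSemigroup f).integrableOn_Ioc)
  rw [setAverage_eq, Real.volume_real_Ioc_of_le hε.le, sub_zero,
    ← intervalIntegral.integral_of_le hε.le] at h
  exact h

end IsSymmetricContractionSemigroup

/-! ### The three implications -/

/-- The exponential decay of the `L²` norm along orbits that start in the domain of the generator,
up to an `L¹` term. -/
theorem SuperPoincareOn.norm_sq_le_of_hasNegGenerator (hT : IsSymmetricContractionSemigroup T)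
    {β : ℝ → ℝ} (hβ : ∀ r : ℝ, 0 < r → 0 < β r)
    (hA : SuperPoincareOn (negGenerator T) β (Ioi 0)) {f h : Lp 𝕜 2 μ}
    (hf : HasNegGenerator T f h) (hf₁ : MemLp f 1 μ) {t r : ℝ} (ht : 0 ≤ t) (hr : 0 < r) :
    ‖extendedSemigroup T t f‖ ^ 2 ≤ Real.exp (-2 * t / r) * ‖f‖ ^ 2 +
      (1 - Real.exp (-2 * t / r)) * β r * normOne f ^ 2 := by
  set E := extendedSemigroup T with hE
  set c := β r * normOne f ^ 2 with hc
  have hpoin : ∀ x, 0 ≤ x → ‖E x f‖ ^ 2 ≤ r * re ⟪E x h, E x f⟫_𝕜 + c := fun x hx => by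
    have hgen := hT.hasNegGenerator_extendedSemigroup hf hx
    have hle := hT.eLpNorm_one_extendedSemigroup_le x hf₁
    have hmem : MemLp (E x f) 1 μ := ⟨Lp.aestronglyMeasurable _, hle.trans_lt hf₁.2⟩
    have h₁ := hA ⟨E x f, _, hgen⟩ hmem r hr
    rw [(negGenerator_spec T ⟨E x f, _, hgen⟩).unique hgen] at h₁
    refine h₁.trans ?_
    have h₂ := normOne_le_normOne hf₁ hle
    have h₃ := normOne_nonneg (E x f)
    have h₄ := (hβ r hr).le
    rw [hc]
    gcongr
  have hexp : ∀ x, HasDerivAt (fun x : ℝ => Real.exp (2 * x / r)) (Real.exp (2 * x / r) * (2 / r))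
      x := fun x => by
    have := (((hasDerivAt_id x).const_mul 2).div_const r).exp
    simpa using this
  have hnorm : ∀ x, 0 ≤ x → HasDerivWithinAt (fun x => ‖E x f‖ ^ 2) (-2 * re ⟪E x h, E x f⟫_𝕜)
      (Ici x) x := fun x hx => by
    have h₁ := hT.hasDerivWithinAt_extendedSemigroup hf hx
    have h₂ := (reCLM (K := 𝕜)).hasFDerivAt.comp_hasDerivWithinAt x (h₁.inner 𝕜 h₁)
    refine (h₂.congr_deriv ?_).congr (fun y _ => norm_sq_eq_re_inner (𝕜 := 𝕜) (E y f))
      (norm_sq_eq_re_inner (𝕜 := 𝕜) (E x f))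
    simp only [reCLM_apply, inner_neg_left, inner_neg_right, map_add, map_neg]
    rw [inner_re_symm (extendedSemigroup T x f)]
    ring
  -- The integrating factor `e^{2x/r}` makes `e^{2x/r} (u(x) - c)` have nonpositive right
  -- derivative, so it stays below its initial value.
  have hmono := image_le_of_deriv_right_le_deriv_boundary (a := 0) (b := t)
    (f := fun x => Real.exp (2 * x / r) * (‖E x f‖ ^ 2 - c))
    (f' := fun x => Real.exp (2 * x / r) * (2 / r) * (‖E x f‖ ^ 2 - c) +
      Real.exp (2 * x / r) * (-2 * re ⟪E x h, E x f⟫_𝕜))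
    (B := fun _ => ‖f‖ ^ 2 - c) (B' := fun _ => 0)
    (by
      have := hT.continuous_extendedSemigroup f
      exact Continuous.continuousOn (by fun_prop))
    (fun x hx => (hexp x).hasDerivWithinAt.mul ((hnorm x hx.1).sub_const c))
    (by simp [hE, extendedSemigroup_of_nonpos le_rfl])
    continuousOn_const (fun x _ => hasDerivWithinAt_const ..)
    (fun x hx => by
      have h₁ := hpoin x hx.1
      have h₂ : Real.exp (2 * x / r) * (2 / r) * (‖E x f‖ ^ 2 - c) +
          Real.exp (2 * x / r) * (-2 * re ⟪E x h, E x f⟫_𝕜) =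
          Real.exp (2 * x / r) * (2 / r) * (‖E x f‖ ^ 2 - (r * re ⟪E x h, E x f⟫_𝕜 + c)) := by
        field_simp
        ring
      rw [h₂]
      exact mul_nonpos_of_nonneg_of_nonpos (by positivity) (sub_nonpos.2 h₁))
    (right_mem_Icc.2 ht)
  have hexp' : Real.exp (-2 * t / r) * Real.exp (2 * t / r) = 1 := by
    rw [← Real.exp_add, ← Real.exp_zero]
    congr 1
    ring
  have h₁ := mul_le_mul_of_nonneg_left hmono (Real.exp_pos (-2 * t / r)).le
  rw [← mul_assoc, hexp', one_mul] at h₁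
  rw [mul_assoc, ← hc]
  linarith

theorem SuperPoincareOn.norm_sq_le (hT : IsSymmetricContractionSemigroup T)
    {β : ℝ → ℝ} (hβ : ∀ r : ℝ, 0 < r → 0 < β r)
    (hA : SuperPoincareOn (negGenerator T) β (Ioi 0)) {f : Lp 𝕜 2 μ}
    (hf : MemLp f 1 μ) {t r : ℝ} (ht : 0 < t) (hr : 0 < r) :
    ‖T t f‖ ^ 2 ≤ Real.exp (-2 * t / r) * ‖f‖ ^ 2 +
      (1 - Real.exp (-2 * t / r)) * β r * normOne f ^ 2 := by
  have hlim := hT.tendsto_average f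
  refine le_of_tendsto_of_tendsto ((((T t).continuous.tendsto f).comp hlim).norm.pow 2)
    (((hlim.norm.pow 2).const_mul _).add_const _) ?_
  filter_upwards [self_mem_nhdsWithin] with ε (hε : 0 < ε)
  have hle := hT.eLpNorm_one_average_le hf hε
  have h₁ := hA.norm_sq_le_of_hasNegGenerator hT hβ (hT.hasNegGenerator_average f hε.le)
    ⟨Lp.aestronglyMeasurable _, hle.trans_lt hf.2⟩ ht.le hr
  rw [extendedSemigroup_of_pos ht] at h₁
  refine h₁.trans ?_
  have h₂ := normOne_le_normOne hf hle
  have h₃ := normOne_nonneg (ε⁻¹ • ∫ s in 0..ε, extendedSemigroup T s f)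
  have h₄ := (hβ r hr).le
  have h₅ : 0 ≤ 1 - Real.exp (-2 * t / r) := by
    rw [sub_nonneg, Real.exp_le_one_iff]
    exact div_nonpos_of_nonpos_of_nonneg (by linarith) hr.le
  gcongr

theorem superPoincareOn_idSub (hT : IsSymmetricContractionSemigroup T) {β : ℝ → ℝ}
    (h : ∀ f : Lp 𝕜 2 μ, MemLp f 1 μ → ∀ t r : ℝ, 0 < t → 0 < r →
      ‖T t f‖ ^ 2 ≤ Real.exp (-2 * t / r) * ‖f‖ ^ 2 +
        (1 - Real.exp (-2 * t / r)) * β r * normOne f ^ 2) {t : ℝ} (ht : 0 < t) :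
    SuperPoincareOn (idSub (T t)) (fun r => β (t / Real.log (1 + 1 / (r - 1)))) (Ioi 1) := by
  rintro ⟨f, hf⟩ hf₁ r (hr : 1 < r)
  have hr₁ : 0 < r - 1 := sub_pos.2 hr
  have hlog : 0 < Real.log (1 + 1 / (r - 1)) := Real.log_pos (by
    have : 0 < 1 / (r - 1) := by positivity
    linarith)
  set ρ := t / Real.log (1 + 1 / (r - 1)) with hρ
  -- `ρ` is chosen so that `e^{-t/ρ} = 1 - 1/r`; multiplying 2 by `r` then clears the coefficient of
  -- the `L¹` term.
  have hexp : Real.exp (-2 * (t / 2) / ρ) = 1 - 1 / r := by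
    have h₁ : -2 * (t / 2) / ρ = -Real.log (1 + 1 / (r - 1)) := by
      rw [hρ]
      field_simp
    rw [h₁, Real.exp_neg, Real.exp_log (by positivity)]
    field_simp
    ring
  have h₁ := h f hf₁ (t / 2) ρ (by positivity) (by positivity)
  have hhalf : ‖T (t / 2) f‖ ^ 2 = re ⟪T t f, f⟫_𝕜 := by
    have h₂ := hT.map_add (t / 2) (t / 2) (by positivity) (by positivity)
    rw [add_halves] at h₂
    rw [h₂, ContinuousLinearMap.comp_apply, hT.symmetric _ (by positivity),
      ← norm_sq_eq_re_inner]
  rw [hexp, hhalf, sub_sub_cancel] at h₁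
  have hB : re ⟪idSub (T t) ⟨f, hf⟩, f⟫_𝕜 = ‖f‖ ^ 2 - re ⟪T t f, f⟫_𝕜 := by
    change re ⟪f - T t f, f⟫_𝕜 = _
    rw [inner_sub_left, map_sub, ← norm_sq_eq_re_inner]
  change ‖f‖ ^ 2 ≤ r * re ⟪idSub (T t) ⟨f, hf⟩, f⟫_𝕜 + β ρ * normOne f ^ 2
  rw [hB]
  have hr₀ : 0 < r := by linarith
  have h₂ := mul_le_mul_of_nonneg_left h₁ hr₀.le
  have h₃ : r * ((1 - 1 / r) * ‖f‖ ^ 2 + 1 / r * β ρ * normOne f ^ 2) =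
      r * ‖f‖ ^ 2 - ‖f‖ ^ 2 + β ρ * normOne f ^ 2 := by
    field_simp
  linarith

theorem superPoincareOn_negGenerator {β : ℝ → ℝ}
    (h : ∀ t : ℝ, 0 < t →
      SuperPoincareOn (idSub (T t)) (fun r => β (t / Real.log (1 + 1 / (r - 1)))) (Ioi 1)) :
    SuperPoincareOn (negGenerator T) β (Ioi 0) := by
  rintro f hf r (hr : 0 < r)
  have hgen : Tendsto (fun t : ℝ => re ⟪(t : 𝕜)⁻¹ • ((f : Lp 𝕜 2 μ) - T t f), (f : Lp 𝕜 2 μ)⟫_𝕜)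
      (𝓝[>] 0) (𝓝 (re ⟪negGenerator T f, (f : Lp 𝕜 2 μ)⟫_𝕜)) :=
    (continuous_re.tendsto _).comp ((negGenerator_spec T f).inner tendsto_const_nhds)
  -- This is the reciprocal of the difference quotient of `1 - e^{-t/r}` at `0`, whose derivative
  -- there is `1/r`.
  have hcoef : Tendsto (fun t : ℝ => t / (1 - Real.exp (-t / r))) (𝓝[>] 0) (𝓝 r) := by
    have h₁ : HasDerivAt (fun t : ℝ => 1 - Real.exp (-t / r)) r⁻¹ 0 := by
      have := (((hasDerivAt_id (0 : ℝ)).neg.div_const r).exp).const_sub 1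
      simpa [neg_div] using this
    have h₂ := ((hasDerivWithinAt_iff_tendsto_slope' (by simp)).1
      (h₁.hasDerivWithinAt (s := Ioi 0))).inv₀ (inv_ne_zero hr.ne')
    rw [inv_inv] at h₂
    refine h₂.congr fun t => ?_
    simp [slope_def_field]
  refine ge_of_tendsto ((hcoef.mul hgen).add_const _) ?_
  filter_upwards [self_mem_nhdsWithin] with t (ht : 0 < t)
  have hexp : Real.exp (-t / r) < 1 := by
    rw [Real.exp_lt_one_iff]
    exact div_neg_of_neg_of_pos (by linarith) hr
  have hexp₀ := Real.exp_pos (-t / r)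
  set e := Real.exp (-t / r) with he
  have he₁ : 0 < 1 - e := sub_pos.2 hexp
  have hR : 1 < (1 - e)⁻¹ := (one_lt_inv₀ he₁).2 (by linarith)
  have hrate : t / Real.log (1 + 1 / ((1 - e)⁻¹ - 1)) = r := by
    have h₁ : 1 + 1 / ((1 - e)⁻¹ - 1) = e⁻¹ := by
      have : (1 - e)⁻¹ - 1 = e / (1 - e) := by
        field_simp
        ring
      rw [this]
      field_simp
      ring
    rw [h₁, Real.log_inv, he, Real.log_exp]
    field_simp
  have h₁ := h t ht ⟨f, trivial⟩ hf (1 - e)⁻¹ hR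
  simp only [hrate] at h₁
  refine h₁.trans (le_of_eq ?_)
  congr 1
  change (1 - e)⁻¹ * re ⟪(f : Lp 𝕜 2 μ) - T t f, (f : Lp 𝕜 2 μ)⟫_𝕜 = _
  rw [inner_smul_left, map_inv₀, conj_ofReal, ← ofReal_inv, re_ofReal_mul]
  field_simp

end Semigroup

theorem mainTheorem3 {X : Type*} [MeasurableSpace X] (μ : Measure X) [SigmaFinite μ]
    {𝕜 : Type*} [RCLike 𝕜] (T : ℝ → Lp 𝕜 2 μ →L[𝕜] Lp 𝕜 2 μ)
    (hT : IsSymmetricContractionSemigroup T) (β : ℝ → ℝ) (hβ : ∀ r : ℝ, 0 < r → 0 < β r) :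
    List.TFAE [
      SuperPoincareOn (negGenerator T) β (Ioi 0),
      ∀ f : Lp 𝕜 2 μ, MemLp f 1 μ → ∀ t r : ℝ, 0 < t → 0 < r →
        ‖T t f‖ ^ 2 ≤ Real.exp (-2 * t / r) * ‖f‖ ^ 2 +
          (1 - Real.exp (-2 * t / r)) * β r * normOne f ^ 2,
      ∀ t : ℝ, 0 < t →
        SuperPoincareOn (idSub (T t)) (fun r => β (t / Real.log (1 + 1 / (r - 1)))) (Ioi 1)] := by
  tfae_have 1 → 2 := fun h f hf t r ht hr => h.norm_sq_le hT hβ hf ht hr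
  tfae_have 2 → 3 := fun h t ht => superPoincareOn_idSub hT h ht
  tfae_have 3 → 1 := superPoincareOn_negGenerator
  tfae_finish
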